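/- \textbf{Setting.} A finite poset $P$ with $n$ elements is a \emph{unit interval order} if there is an injective map $q\colon P\to\mathbb{R}$ such that $x<_P y$ if and only if $q(x)+1<q(y)$. A bijective labeling of $P$ by $[n]=\{1,\dots,n\}$ is \emph{canonical} if the element with the smaller value of $\alpha(x)=|\{y\le_P x\}|-|\{y\ge_P x\}|$ gets the smaller label whenever these values differ. With respect to such a labeling, let $A=(a_{i,j})$ be the $n\times n$ matrix with $a_{i,j}=0$ if $i<_P j$ and $a_{i,j}=1$ otherwise, and let $\psi(A)$ be the $n\times 2n$ matrix formed by the identity matrix followed by the block whose $r$-th row is $(-1)^{n-r}(a_{n+1-r,1},\dots,a_{n+1-r,n})$. A \emph{(rank $n$) unit interval positroid} is a matroid on $[2n]$ represented over $\mathbb{R}$ by the columns of such a matrix $\psi(A)$. A \emph{decorated permutation} of $[m]$ is a permutation of $[m]$ each of whose fixed points is marked either clockwise or counterclockwise. The decorated permutation $\pi$ associated to a positroid on $[m]$ is defined as follows, indices being taken modulo $m$. Let $I_i$ be the lexicographically minimal basis with respect to the order $i<_i i+1<_i\dots<_i m<_i 1<_i\dots<_i i-1$. If $i\in I_i$ and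 $I_{i+1}=(I_i\setminus\{i\})\cup\{j\}$, then $\pi(j)=i$ (a counterclockwise fixed point if $j=i$); if $i\notin I_i$ and $I_{i+1}=I_i$, then $i$ is a clockwise fixed point of $\pi$. Place $1,\dots,m$ clockwise on a circle, represent $\pi$ by the chords $k\to\pi(k)$ (a fixed point being a loop), and let $\mathrm{Arc}(X,Y)$ be the set of the points from $X$ to $Y$ in clockwise order, both included. A \emph{simple crossing} of $\pi$ is a pair of chords $A\to D$, $C\to B$ with $A\ne C$ such that, in one clockwise turn starting at $C$, the points $C,A,B,D$ are met in this order, where $A=B$ is allowed and $D=C$ (reached at the end of the turn) is allowed, and such that no other chord goes from a point of $\mathrm{Arc}(C,A)$ to a point of $\mathrm{Arc}(B,D)$. We say that $\pi$ \emph{covers} $\pi'$ (in the cyclic Bruhat order) if the chord diagram of $\pi'$ is obtained from that of $\pi$ by replacing the chords $A\to D$, $C\to B$ of a simple crossing by the simple alignment $A\to B$, $C\to D$, where $A\to B$ becomes a counterclockwise loop if $A=B$ and $C\to D$ becomes a clockwise loop if $C=D$, all other chords and markings being unchanged. Two positroid cells are \emph{adjacent} if the decorated permutations of the positroids labeling them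 cover a common decorated permutation. \textbf{Proposition.} Let $P_1$ and $P_2$ be two distinct rank $n$ unit interval positroids on $[2n]$, and let $\pi_1$ and $\pi_2$ be their respective decorated permutations. Then $P_1$ and $P_2$ label adjacent positroid cells if and only if there exists $i\in[2n]\setminus\{1,n+1\}$ such that removing $i$ from the cycle decompositions of $\pi_1$ and of $\pi_2$ (that is, replacing $(\cdots a\ i\ b\cdots)$ by $(\cdots a\ b\cdots)$) gives the same result. -/

import Mathlib

/-! Throughout, the element `k` of `[m] = {1, …, m}` is the element `k - 1` of `Fin m`.
Subtraction in `Fin m` is taken modulo `m`, so that `b - a` is the clockwise distance from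
`a` to `b` when `1, …, m` are placed clockwise around a circle. -/

namespace UnitIntervalPositroid

/-! ### Unit interval orders and their antiadjacency matrices -/

/-- `P` is a unit interval order: its elements `x` correspond bijectively to closed unit intervals
`[q x, q x + 1]` such that `x < y` if and only if the interval of `x` lies strictly to the left of
the interval of `y`. -/
def IsUnitIntervalOrder (P : Type) [PartialOrder P] : Prop :=
  ∃ q : P → ℝ, Function.Injective q ∧ ∀ x y : P, x < y ↔ q x + 1 < q y

/-- The altitude of `x`: the size of the order ideal of `x` minus the size of its dual order
ideal. -/
noncomputable def altitude {P : Type} [PartialOrder P] (x : P) : ℤ :=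
  (Nat.card (Set.Iic x) : ℤ) - (Nat.card (Set.Ici x) : ℤ)

/-- A labeling of `P` by `[n]` is canonical if it respects altitude. -/
def IsCanonicalLabeling {P : Type} [PartialOrder P] {n : ℕ} (l : P ≃ Fin n) : Prop :=
  ∀ x y : P, altitude x < altitude y → l x < l y

open Classical in
/-- The antiadjacency matrix of a labeled poset. -/
noncomputable def antiadjacency {P : Type} [PartialOrder P] {n : ℕ} (l : P ≃ Fin n) :
    Matrix (Fin n) (Fin n) ℝ :=
  Matrix.of fun i j => if l.symm i < l.symm j then 0 else 1

/-- The `n × 2n` matrix attached to an `n × n` matrix `A = (a_{i,j})`: the identity matrix followed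
by the block whose row `r` (for `r = 1, …, n`) is `(-1)^{n-r} (a_{n+1-r,1}, …, a_{n+1-r,n})`. -/
def psi {n : ℕ} (A : Matrix (Fin n) (Fin n) ℝ) : Matrix (Fin n) (Fin (2 * n)) ℝ :=
  Matrix.of fun i j =>
    if h : (j : ℕ) < n then (if (i : ℕ) = (j : ℕ) then 1 else 0)
    else (-1) ^ (n - 1 - (i : ℕ)) * A i.rev ⟨(j : ℕ) - n, by omega⟩

/-! ### Positroids, Grassmann necklaces and decorated permutations -/

/-- `M` is the matroid on `[m]` represented by the `d × m` matrix `B`: its bases are the sets of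
column indices whose columns form a basis of `ℝ^d`. -/
def IsRepresentedBy {d m : ℕ} (M : Matroid (Fin m)) (B : Matrix (Fin d) (Fin m) ℝ) : Prop :=
  M.E = Set.univ ∧
    ∀ S : Set (Fin m), M.IsBase S ↔
      LinearIndepOn ℝ (fun j => B.col j) S ∧
        Submodule.span ℝ ((fun j => B.col j) '' S) = ⊤

/-- `M` is the positroid on `[2n]` induced by some unit interval order of cardinality `n`, through
its antiadjacency matrix with respect to a canonical labeling. -/
def IsUnitIntervalPositroid (n : ℕ) (M : Matroid (Fin (2 * n))) : Prop :=
  ∃ (P : Type) (_ : PartialOrder P) (l : P ≃ Fin n),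
    IsUnitIntervalOrder P ∧ IsCanonicalLabeling l ∧ IsRepresentedBy M (psi (antiadjacency l))

/-- `S` strictly precedes `T` lexicographically, for sets of the same size whose elements are
written in increasing order with respect to the shifted order `i <_i ⋯ <_i m <_i 1 <_i ⋯ <_i i-1`
(here `b <_i a` is `b - i < a - i`): the `<_i`-smallest element in which they differ is in `S`. -/
def LexLT {m : ℕ} (i : Fin m) (S T : Finset (Fin m)) : Prop :=
  ∃ a, a ∈ S ∧ a ∉ T ∧ ∀ b : Fin m, b - i < a - i → (b ∈ S ↔ b ∈ T)

/-- `I` is the Grassmann necklace of `M`: each `I i` is the lexicographically minimal base of `M`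
with respect to the shifted order starting at `i`. -/
def IsGrassmannNecklaceOf {m : ℕ} (I : Fin m → Finset (Fin m)) (M : Matroid (Fin m)) : Prop :=
  ∀ i : Fin m, M.IsBase (I i : Set (Fin m)) ∧
    ∀ T : Finset (Fin m), M.IsBase (T : Set (Fin m)) → T ≠ I i → LexLT i (I i) T

/-- A decorated permutation of `[m]`: a permutation together with the set of those fixed points
that are marked counterclockwise (the other fixed points are marked clockwise). -/
@[ext]
structure DecoratedPerm (m : ℕ) where
  /-- the underlying permutation -/
  perm : Equiv.Perm (Fin m)
  /-- the counterclockwise fixed points -/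
  ccw : Finset (Fin m)
  ccw_fixed : ∀ i ∈ ccw, perm i = i

/-- `π` is the decorated permutation of the necklace `I`; `finRotate m i` is `i + 1` modulo `m`.
If `I_{i+1} = (I_i ∖ {i}) ∪ {j}` with `i ∈ I_i`, then `π j = i`, counterclockwise if `j = i`; if
`i ∉ I_i` and `I_{i+1} = I_i`, then `i` is a clockwise fixed point. -/
def IsDecoratedPermOfNecklace {m : ℕ} (π : DecoratedPerm m) (I : Fin m → Finset (Fin m)) : Prop :=
  ∀ i : Fin m,
    (∀ j : Fin m, i ∈ I i → I (finRotate m i) = insert j ((I i).erase i) →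
      π.perm j = i ∧ (j = i → i ∈ π.ccw)) ∧
    (i ∉ I i → I (finRotate m i) = I i → π.perm i = i ∧ i ∉ π.ccw)

/-- `π` is the decorated permutation associated to the positroid `M`. -/
def IsDecoratedPermOf {m : ℕ} (π : DecoratedPerm m) (M : Matroid (Fin m)) : Prop :=
  ∃ I : Fin m → Finset (Fin m), IsGrassmannNecklaceOf I M ∧ IsDecoratedPermOfNecklace π I

/-! ### Chord diagrams and the cyclic Bruhat order -/

/-- The points on the circle from `i` to `j` in clockwise order, both included. -/
def arc {m : ℕ} (i j : Fin m) : Set (Fin m) :=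
  {k | k - i ≤ j - i}

/-- Going around the circle once clockwise from `C`, one meets `C`, `A`, `B`, `D` in this order,
where `A = B` is allowed and `D` may be `C` itself, reached again at the end of the turn, but
`C ≠ A` and `B ≠ D`. For distinct sources `A`, `C` and distinct targets `B`, `D`, this is exactly
the position in which the chords `A → D` and `C → B` meet inside or on the circle, and the chords
`A → B` and `C → D` are parallel. -/
def InClockwiseOrder {m : ℕ} (C A B D : Fin m) : Prop :=
  C ≠ A ∧ A - C ≤ B - C ∧ (B - C < D - C ∨ D = C)

/-- No chord other than those starting at `A` and `C` goes from `Arc(C, A)` to `Arc(B, D)`. -/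
def NoOtherChords {m : ℕ} (π : DecoratedPerm m) (A B C D : Fin m) : Prop :=
  ∀ k ∈ arc C A, k ≠ A → k ≠ C → π.perm k ∉ arc B D

/-- The chords `A → D` and `C → B` of `π` form a simple crossing. -/
def IsSimpleCrossing {m : ℕ} (π : DecoratedPerm m) (A B C D : Fin m) : Prop :=
  InClockwiseOrder C A B D ∧ π.perm A = D ∧ π.perm C = B ∧ NoOtherChords π A B C D

/-- The chords `A → B` and `C → D` of `π` form a simple alignment. If `A = B`, the first chord is a
counterclockwise loop; if `C = D`, the second chord is a clockwise loop. -/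
def IsSimpleAlignment {m : ℕ} (π : DecoratedPerm m) (A B C D : Fin m) : Prop :=
  InClockwiseOrder C A B D ∧ π.perm A = B ∧ π.perm C = D ∧
    (A = B → A ∈ π.ccw) ∧ (C = D → C ∉ π.ccw) ∧ NoOtherChords π A B C D

/-- `π₁` covers `π₂` in the cyclic Bruhat order: the chord diagram of `π₂` is obtained from that of
`π₁` by turning a simple crossing into a simple alignment, all other chords being unchanged. -/
def Covers {m : ℕ} (π₁ π₂ : DecoratedPerm m) : Prop :=
  ∃ A B C D : Fin m, IsSimpleCrossing π₁ A B C D ∧ IsSimpleAlignment π₂ A B C D ∧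
    ∀ k : Fin m, k ≠ A → k ≠ C → π₂.perm k = π₁.perm k ∧ (k ∈ π₂.ccw ↔ k ∈ π₁.ccw)

/-- The positroid cells labeled by `M₁` and `M₂` are adjacent: the decorated permutations
parameterizing them cover a common decorated permutation. -/
def LabelAdjacentCells {m : ℕ} (M₁ M₂ : Matroid (Fin m)) : Prop :=
  ∃ π₁ π₂ π : DecoratedPerm m, IsDecoratedPermOf π₁ M₁ ∧ IsDecoratedPermOf π₂ M₂ ∧
    Covers π₁ π ∧ Covers π₂ π

/-- The permutation obtained by removing `i` from the cycle decomposition of `σ`: a cycle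
`(⋯ a i b ⋯)` becomes `(⋯ a b ⋯)`, the point `i` is sent to itself and nothing else changes. -/
def removeFromCycles {m : ℕ} (σ : Equiv.Perm (Fin m)) (i : Fin m) : Equiv.Perm (Fin m) :=
  Equiv.swap i (σ i) * σ

end UnitIntervalPositroid

namespace UnitIntervalPositroid

/-! ### Cyclic distances -/

/-! The matroid of `ψ(A)` is graphic. On the vertices `0, …, n`, a column `k ≤ n` is, up to sign,
the edge from `k - 1` to `k`, and the `j`-th column of the second block is an edge from `0` to a
height that decreases weakly in `j` from `n` (`exists_isStaircase`). By `perm_apply_eq_of_mem_span`,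
`π x = y` as soon as edge `x` is the one whose arrival first closes a cycle through edge `y`.
Explicit cycles and cuts then show that `π` is a single cycle which, read after `n + 1`, shuffles
`1, …, n` in increasing order with `n + 1, …, 2n` in decreasing order
(`IsStaircase.exists_isShuffleCycle`).

In such a cycle every initial segment occupies an arc of the circle. Two disjoint pairs of
consecutive elements therefore never interlace, so a crossing that avoids the chord from `n + 1` to
`1` has the form `a → i → b`, and resolving it removes `i` from the cycle (`exists_of_covers`).
Conversely, every `i ≠ 1, n + 1` can be removed by a cover, with a marking that depends on `i` alone
(`covers_loopAt`). If both permutations cover a common one, the two covers are of the same kind. Two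
removals produce the same loop `i`; two covers through the chord from `n + 1` force the cycles to be
equal, and any `i` then works. Distinctness matters only to ensure `n ≥ 2`, so that some `i` is
available. -/

lemma val_sub_eq {m : ℕ} (a b : Fin m) :
    (a - b).val = if b.val ≤ a.val then a.val - b.val else m + a.val - b.val := by
  have ha := a.isLt
  have hb := b.isLt
  rw [Fin.val_sub]
  split_ifs with h
  · rw [show m - b.val + a.val = m + (a.val - b.val) by omega, Nat.add_mod_left,
      Nat.mod_eq_of_lt (by omega)]
  · rw [Nat.mod_eq_of_lt (by omega)]
    omega

lemma val_finRotate_eq {m : ℕ} (a : Fin m) :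
    (finRotate m a).val = if a.val + 1 = m then 0 else a.val + 1 := by
  cases m with
  | zero => exact a.elim0
  | succ k =>
    split_ifs with h
    · have : a = Fin.last k := Fin.ext (by simpa using h)
      subst this
      simp
    · have : a ≠ Fin.last k := fun e => h (by simp [e])
      exact coe_finRotate_of_ne_last this

/-! ### The lexicographically minimal base -/

section Greedy

variable {m : ℕ} {V : Type*} [AddCommGroup V] [Module ℝ V]

/-- The vectors that are not spanned by the preceding ones in the shifted order. -/
def greedyBase (v : Fin m → V) (i : Fin m) : Set (Fin m) :=
  {k | v k ∉ Submodule.span ℝ (v '' {b | b - i < k - i})}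

lemma greedyBase_prefix (v : Fin m → V) (i : Fin m) (s : ℕ) :
    LinearIndepOn ℝ v (greedyBase v i ∩ {k | (k - i).val < s}) ∧
      Submodule.span ℝ (v '' (greedyBase v i ∩ {k | (k - i).val < s})) =
        Submodule.span ℝ (v '' {k | (k - i).val < s}) := by
  induction s with
  | zero => simp
  | succ s ih =>
    obtain ⟨ih1, ih2⟩ := ih
    by_cases hs : s < m
    · obtain ⟨k, hk⟩ : ∃ k : Fin m, (k - i).val = s := by
        have : NeZero m := ⟨by omega⟩
        exact ⟨⟨s, hs⟩ + i, by simp⟩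
      have hset : {b : Fin m | (b - i).val < s + 1} = insert k {b | (b - i).val < s} := by
        ext b
        simp only [Set.mem_ofPred_eq, Set.mem_insert_iff]
        constructor
        · intro hb
          rcases Nat.lt_succ_iff_lt_or_eq.mp hb with hb | hb
          · exact Or.inr hb
          · left
            have : NeZero m := ⟨by omega⟩
            have : b - i = k - i := Fin.ext (by omega)
            exact sub_left_injective this
        · rintro (rfl | hb) <;> omega
      have hpre : {b : Fin m | b - i < k - i} = {b | (b - i).val < s} := by
        ext b
        simp only [Set.mem_ofPred_eq, Fin.lt_def, hk]
      by_cases hG : k ∈ greedyBase v i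
      · have hG' := hG
        rw [greedyBase, Set.mem_ofPred_eq, hpre] at hG'
        rw [hset, Set.inter_insert_of_mem hG]
        refine ⟨ih1.insert (by rwa [ih2]), ?_⟩
        rw [Set.image_insert_eq, Set.image_insert_eq, Submodule.span_insert,
          Submodule.span_insert, ih2]
      · rw [hset, Set.inter_insert_of_notMem hG]
        refine ⟨ih1, ?_⟩
        rw [greedyBase, Set.mem_ofPred_eq, hpre, not_not] at hG
        rw [ih2, Set.image_insert_eq, Submodule.span_insert_eq_span hG]
    · have : {b : Fin m | (b - i).val < s + 1} = {b | (b - i).val < s} := by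
        ext b
        have := (b - i).isLt
        simp only [Set.mem_ofPred_eq]
        omega
      rw [this]
      exact ⟨ih1, ih2⟩

lemma greedyBase_linearIndepOn (v : Fin m → V) (i : Fin m) :
    LinearIndepOn ℝ v (greedyBase v i) ∧
      Submodule.span ℝ (v '' greedyBase v i) = Submodule.span ℝ (Set.range v) := by
  have := greedyBase_prefix v i m
  have h : {k : Fin m | (k - i).val < m} = Set.univ := by
    ext k
    simp
  rwa [h, Set.inter_univ, Set.image_univ] at this

variable {v : Fin m → V} {M : Matroid (Fin m)}

/-- If the two bases differed, minimality would give a first difference `a` lying in `I i` only.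
Then `v a` is spanned by earlier greedy vectors, which also belong to `I i`, against independence.
-/
lemma coe_necklace_eq_greedyBase
    (hM : ∀ S : Set (Fin m), M.IsBase S ↔
      LinearIndepOn ℝ v S ∧ Submodule.span ℝ (v '' S) = ⊤)
    (hv : Submodule.span ℝ (Set.range v) = ⊤) {I : Fin m → Finset (Fin m)}
    (hI : IsGrassmannNecklaceOf I M) (i : Fin m) : (I i : Set (Fin m)) = greedyBase v i := by
  classical
  by_contra hne
  obtain ⟨hind, hsp⟩ := greedyBase_linearIndepOn v i
  have hT : M.IsBase ((greedyBase v i).toFinset : Set (Fin m)) := by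
    rw [Set.coe_toFinset, hM]
    exact ⟨hind, hsp.trans hv⟩
  obtain ⟨a, haI, haG, hab⟩ := (hI i).2 _ hT (fun h => hne (by rw [← h, Set.coe_toFinset]))
  rw [Set.mem_toFinset, greedyBase, Set.mem_ofPred_eq, not_not] at haG
  have h1 := (greedyBase_prefix v i (a - i).val).2
  have hindI := ((hM _).1 (hI i).1).1
  refine hindI.notMem_span (Finset.mem_coe.2 haI) (Submodule.span_mono (Set.image_mono ?_)
    (h1.symm.le haG))
  rintro b ⟨hbG, hb⟩
  rw [Set.mem_ofPred_eq] at hb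
  refine ⟨Finset.mem_coe.2 ((hab b hb).2 (Set.mem_toFinset.2 hbG)), ?_⟩
  rintro rfl
  exact lt_irrefl _ hb

/-- If `v y` is spanned by the vectors strictly after `y` up to `x`, but not without `v x`, then
the decorated permutation sends `x` to `y`. -/
lemma perm_apply_eq_of_mem_span
    (hM : ∀ S : Set (Fin m), M.IsBase S ↔
      LinearIndepOn ℝ v S ∧ Submodule.span ℝ (v '' S) = ⊤)
    (hv : Submodule.span ℝ (Set.range v) = ⊤) {π : DecoratedPerm m} (hπ : IsDecoratedPermOf π M)
    {x y : Fin m} (hxy : x ≠ y)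
    (hmem : v y ∈ Submodule.span ℝ (v '' {k | 0 < (k - y).val ∧ (k - y).val ≤ (x - y).val}))
    (hnot : v y ∉ Submodule.span ℝ (v '' {k | 0 < (k - y).val ∧ (k - y).val < (x - y).val})) :
    π.perm x = y := by
  obtain ⟨I, hI, hπI⟩ := hπ
  have hIG (i k : Fin m) :
      k ∈ I i ↔ v k ∉ Submodule.span ℝ (v '' {b | (b - i).val < (k - i).val}) := by
    rw [← Finset.mem_coe, coe_necklace_eq_greedyBase hM hv hI i]
    rfl
  have hyy : (y - y).val = 0 := by rw [val_sub_eq]; simp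
  have hpos {k : Fin m} (hk : k ≠ y) : 0 < (k - y).val := by
    have := Fin.val_ne_iff.2 hk
    rw [val_sub_eq]
    split_ifs <;> omega
  set z := finRotate m y with hz
  -- Starting from `z = y + 1` instead of `y` moves `y` from first to last place and keeps the order
  -- of the rest.
  have hy1 (k : Fin m) : (k - z).val = if k = y then m - 1 else (k - y).val - 1 := by
    have hk := k.isLt
    have hyl := y.isLt
    have := val_finRotate_eq y
    rw [val_sub_eq, val_sub_eq, hz]
    simp only [Fin.ext_iff]
    split_ifs at * <;> omega
  have hy2 {k : Fin m} (hk : k ≠ y) :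
      {b : Fin m | (b - z).val < (k - z).val} =
        {b | 0 < (b - y).val ∧ (b - y).val < (k - y).val} := by
    ext b
    have h1 := hpos hk
    have h2 := (k - y).isLt
    simp only [Set.mem_ofPred_eq, hy1, if_neg hk]
    by_cases hb : b = y
    · subst hb
      simp only [if_true, hyy]
      omega
    · have := hpos hb
      rw [if_neg hb]
      omega
  have hy3 {k : Fin m} (hk : k ≠ y) :
      {b : Fin m | (b - y).val < (k - y).val} =
        insert y {b | 0 < (b - y).val ∧ (b - y).val < (k - y).val} := by
    ext b
    have h1 := hpos hk
    simp only [Set.mem_ofPred_eq, Set.mem_insert_iff]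
    by_cases hb : b = y
    · subst hb
      simp only [hyy, true_or, iff_true]
      exact h1
    · have := hpos hb
      simp only [hb, false_or]
      omega
  have hle {k : Fin m} (hk : k ≠ y) :
      {b : Fin m | 0 < (b - y).val ∧ (b - y).val ≤ (k - y).val} =
        insert k {b | 0 < (b - y).val ∧ (b - y).val < (k - y).val} := by
    ext b
    have h1 := hpos hk
    simp only [Set.mem_ofPred_eq, Set.mem_insert_iff]
    have : b = k ↔ (b - y).val = (k - y).val := by
      have : NeZero m := ⟨by have := y.isLt; omega⟩
      rw [← Fin.ext_iff, sub_left_inj]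
    rw [this]
    omega
  have hle' {k : Fin m} {r : ℕ} (hr : (k - y).val < r) :
      Submodule.span ℝ (v '' {b | 0 < (b - y).val ∧ (b - y).val ≤ (k - y).val}) ≤
        Submodule.span ℝ (v '' {b | 0 < (b - y).val ∧ (b - y).val < r}) :=
    Submodule.span_mono (Set.image_mono fun b hb => ⟨hb.1, hb.2.trans_lt hr⟩)
  have hyI : y ∈ I y := by
    rw [hIG, hyy]
    intro h
    simp only [not_lt_zero, Set.ofPred_false, Set.image_empty, Submodule.span_empty,
      Submodule.mem_bot] at h
    exact hnot (h ▸ Submodule.zero_mem _)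
  refine ((hπI y).1 x hyI ?_).1
  ext k
  rw [Finset.mem_insert, Finset.mem_erase]
  by_cases hk : k = y
  · subst hk
    refine iff_of_false ?_ (by simp [hxy.symm])
    rw [hIG, not_not]
    refine Submodule.span_mono (Set.image_mono fun b hb => ?_) hmem
    have hb0 := hb.1
    have hbk : b ≠ k := by
      rintro rfl
      omega
    have := (b - k).isLt
    rw [Set.mem_ofPred_eq, hy1, hy1, if_neg hbk, if_pos rfl]
    omega
  · rw [hIG, hIG, hy2 hk, hy3 hk]
    simp only [ne_eq, hk, not_false_eq_true, true_and]
    constructor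
    · intro hkI
      by_contra! hcon
      obtain ⟨hkx, hkY⟩ := hcon
      rw [Set.image_insert_eq] at hkY
      -- By exchange, `k` is the point whose arrival makes `v y` dependent. This forces `k = x`:
      -- before `x` it contradicts `hnot`, and after `x` the vector `v y` is already spanned, so
      -- inserting it changes nothing.
      have hex := mem_span_insert_exchange hkY hkI
      rw [← Set.image_insert_eq, ← hle hk] at hex
      have hne : (k - y).val ≠ (x - y).val := by
        have : NeZero m := ⟨by have := y.isLt; omega⟩
        rwa [Ne, ← Fin.ext_iff, sub_left_inj]
      rcases lt_or_gt_of_ne hne with h | h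
      · exact hnot (hle' h hex)
      · rw [Submodule.span_insert_eq_span (hle' h hmem)] at hkY
        exact hkI hkY
    · rintro (rfl | h)
      · intro h
        rw [hle hxy, Set.image_insert_eq, Submodule.span_insert_eq_span h] at hmem
        exact hnot hmem
      · exact fun h' => h (Submodule.span_mono (Set.image_mono (Set.subset_insert _ _)) h')

end Greedy

/-! ### Permutations read off a Dyck path -/

/-- `σ` is a cycle in which, starting right after `n + 1`, the elements `1, …, n` appear in
increasing order and `n + 1, …, 2n` in decreasing order; `w` gives the place of each element. -/
structure IsShuffleCycle {n : ℕ} (σ : Equiv.Perm (Fin (2 * n))) (w : Fin (2 * n) → ℕ) : Prop where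
  injective : Function.Injective w
  up : ∀ x y, x.val < y.val → y.val < n → w x < w y
  down : ∀ x y, n ≤ x.val → x.val < y.val → w y < w x
  succ : ∀ x, x.val ≠ n → w (σ x) = w x + 1
  last : ∀ x, x.val = n → (σ x).val = 0

namespace IsShuffleCycle

variable {n : ℕ} {σ : Equiv.Perm (Fin (2 * n))} {w : Fin (2 * n) → ℕ}

lemma apply_ne (h : IsShuffleCycle σ w) (x : Fin (2 * n)) : σ x ≠ x := by
  intro hx
  have hlt := x.isLt
  by_cases hn : x.val = n
  · have := h.last x hn
    rw [hx] at this
    omega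
  · have := h.succ x hn
    rw [hx] at this
    omega

lemma perm_unique (h : IsShuffleCycle σ w) {σ' : Equiv.Perm (Fin (2 * n))}
    (h' : IsShuffleCycle σ' w) : σ = σ' := by
  ext1 x
  by_cases hx : x.val = n
  · exact Fin.ext ((h.last x hx).trans (h'.last x hx).symm)
  · exact h.injective ((h.succ x hx).trans (h'.succ x hx).symm)

/-- The comparisons in a form usable by `omega` once the half containing each point is known. -/
lemma lt_iff (h : IsShuffleCycle σ w) (x y : Fin (2 * n)) :
    (x.val < n → y.val < n → (w x < w y ↔ x.val < y.val)) ∧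
    (¬ x.val < n → ¬ y.val < n → (w x < w y ↔ y.val < x.val)) ∧
    (w x = w y ↔ x.val = y.val) := by
  have h1 := h.up x y
  have h2 := h.up y x
  have h3 := h.down x y
  have h4 := h.down y x
  have h5 : w x = w y ↔ x.val = y.val := by rw [h.injective.eq_iff, Fin.ext_iff]
  refine ⟨fun _ _ => ?_, fun _ _ => ?_, h5⟩ <;> omega

/-! ### Resolving a crossing of a shuffle cycle -/

lemma val_of_inClockwiseOrder {m : ℕ} {A B C D : Fin m} (h : InClockwiseOrder C A B D) :
    C.val < A.val ∧ A.val ≤ B.val ∧ B.val < D.val ∨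
    D.val ≤ C.val ∧ C.val < A.val ∧ A.val ≤ B.val ∨
    B.val < D.val ∧ D.val ≤ C.val ∧ C.val < A.val ∨
    A.val ≤ B.val ∧ B.val < D.val ∧ D.val ≤ C.val := by
  obtain ⟨hCA, h1, h2⟩ := h
  rw [Fin.le_def] at h1
  simp only [Fin.lt_def, val_sub_eq, Fin.ext_iff, ne_eq] at h1 h2 hCA
  split_ifs at * <;> omega

/-- Resolving a crossing not involving the chord that starts at `n + 1` creates a loop. -/
lemma loop_of_crossing (h : IsShuffleCycle σ w) {A B C D : Fin (2 * n)}
    (hcl : InClockwiseOrder C A B D) (hA : σ A = D) (hC : σ C = B) (hAn : A.val ≠ n)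
    (hCn : C.val ≠ n) : A = B ∨ C = D := by
  have hD := h.succ A hAn
  have hB := h.succ C hCn
  rw [hA] at hD
  rw [hC] at hB
  have hcl := val_of_inClockwiseOrder hcl
  -- The four points are now distinct, and `A, D` and `C, B` are consecutive pairs of places. Some
  -- initial segment contains one pair and misses the other; it occupies an arc, so the pairs cannot
  -- interlace as `C, A, B, D` do.
  by_contra! hcon
  simp only [ne_eq, Fin.ext_iff] at hcon
  have e1 := h.lt_iff A B
  have e2 := h.lt_iff A C
  have e3 := h.lt_iff A D
  have e4 := h.lt_iff B C
  have e5 := h.lt_iff B D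
  have e6 := h.lt_iff C D
  clear hA hC h
  by_cases hA : A.val < n <;> by_cases hB : B.val < n <;> by_cases hC : C.val < n <;>
    by_cases hD : D.val < n <;>
    simp only [hA, hB, hC, hD, not_true_eq_false, not_false_eq_true, forall_const,
      IsEmpty.forall_iff, true_and] at e1 e2 e3 e4 e5 e6 <;> omega

lemma removeFromCycles_eq (i : Fin (2 * n)) (x : Fin (2 * n)) :
    removeFromCycles σ i x =
      if σ x = i then σ i else if x = i then i else σ x := by
  rw [removeFromCycles, Equiv.Perm.mul_apply, Equiv.swap_apply_def]
  simp only [EmbeddingLike.apply_eq_iff_eq]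

/-- Another fixed point would form a 2-cycle with `i`, but places increase along every chord except
the one from `n + 1` to `1`. -/
lemma eq_of_removeFromCycles_apply (h : IsShuffleCycle σ w) {i x : Fin (2 * n)} (hi0 : i.val ≠ 0)
    (hin : i.val ≠ n) (hx : removeFromCycles σ i x = x) : x = i := by
  by_contra hxi
  rw [removeFromCycles_eq, if_neg hxi] at hx
  split_ifs at hx with h1
  · have h2 := h.succ i hin
    rw [hx] at h2
    by_cases hxn : x.val = n
    · exact hi0 (h1 ▸ h.last x hxn)
    · have h3 := h.succ x hxn
      rw [h1] at h3
      omega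
  · exact h.apply_ne x hx

/-- Resolving a crossing removes an element different from `1` and `n + 1` from the cycle, or splits
the cycle in two, one part containing `1` and the other `n + 1`. -/
lemma exists_of_covers (h : IsShuffleCycle σ w) {π π' : DecoratedPerm (2 * n)} (hπ : π.perm = σ)
    (hc : Covers π π') :
    (∃ i : Fin (2 * n), i.val ≠ 0 ∧ i.val ≠ n ∧ π'.perm = removeFromCycles σ i) ∨
    ∃ a x : Fin (2 * n), x.val = n ∧ a ≠ x ∧ π'.perm = σ * Equiv.swap a x := by
  obtain ⟨A, B, C, D, ⟨hcl, hA, hC, -⟩, ⟨-, hA', hC', -⟩, hk⟩ := hc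
  rw [hπ] at hA hC
  have hperm : π'.perm = σ * Equiv.swap A C := by
    ext1 k
    rw [Equiv.Perm.mul_apply, Equiv.swap_apply_def]
    split_ifs with h1 h2
    · rw [h1, hA', hC]
    · rw [h2, hC', hA]
    · rw [(hk k h1 h2).1, hπ]
  have h0 {x y : Fin (2 * n)} (hxn : x.val ≠ n) (hxy : σ x = y) : y.val ≠ 0 := by
    intro hy
    have hpos : n < 2 * n := by have := x.isLt; omega
    have hl := h.last ⟨n, hpos⟩ rfl
    have : σ ⟨n, hpos⟩ = σ x := Fin.ext (by rw [hl, hxy, hy])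
    exact hxn (by rw [← σ.injective this])
  by_cases hAn : A.val = n
  · exact Or.inr ⟨C, A, hAn, hcl.1, by rw [hperm, Equiv.swap_comm]⟩
  by_cases hCn : C.val = n
  · exact Or.inr ⟨A, C, hCn, hcl.1.symm, hperm⟩
  left
  rcases h.loop_of_crossing hcl hA hC hAn hCn with rfl | rfl
  · refine ⟨A, h0 hCn hC, hAn, ?_⟩
    rw [hperm, removeFromCycles, Equiv.swap_comm A C, Equiv.mul_swap_eq_swap_mul, hC]
  · refine ⟨C, h0 hAn hA, hCn, ?_⟩
    rw [hperm, removeFromCycles, Equiv.mul_swap_eq_swap_mul, hA]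

/-- The left side fixes `i`, whereas a cut through the chord from `n + 1` can only create the fixed
points `1` and `n + 1`. -/
lemma removeFromCycles_ne_mul_swap {σ' : Equiv.Perm (Fin (2 * n))} {w' : Fin (2 * n) → ℕ}
    (h' : IsShuffleCycle σ' w') {i a x : Fin (2 * n)} (hi0 : i.val ≠ 0)
    (hin : i.val ≠ n) (hx : x.val = n) :
    removeFromCycles σ i ≠ σ' * Equiv.swap a x := by
  intro he
  have hi : removeFromCycles σ i i = i := by
    rw [removeFromCycles_eq]
    split_ifs with h1 h2
    · exact h1
    · rfl
    · exact absurd rfl h2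
  have hix : i ≠ x := fun e => hin (e ▸ hx)
  rw [he, Equiv.Perm.mul_apply, Equiv.swap_apply_def, if_neg hix] at hi
  split_ifs at hi
  · exact hi0 (hi ▸ h'.last x hx)
  · exact h'.apply_ne i hi

/-- The decorated permutation obtained by turning `i` into a loop. -/
def loopAt (σ : Equiv.Perm (Fin (2 * n))) (i : Fin (2 * n)) : DecoratedPerm (2 * n) where
  perm := removeFromCycles σ i
  ccw := if i.val < n then {i} else ∅
  ccw_fixed k hk := by
    split_ifs at hk
    · rw [Finset.mem_singleton] at hk
      subst hk
      rw [removeFromCycles_eq]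
      split_ifs with h1 h2
      · exact h1
      · rfl
      · exact absurd rfl h2
    · simp at hk

/-! ### Every removal is a cover -/

lemma mem_arc {m : ℕ} {a b k : Fin m} : k ∈ arc a b ↔
    a.val ≤ k.val ∧ k.val ≤ b.val ∨ k.val ≤ b.val ∧ b.val < a.val ∨
      b.val < a.val ∧ a.val ≤ k.val := by
  rw [arc, Set.mem_ofPred_eq, Fin.le_def, val_sub_eq, val_sub_eq]
  have := k.isLt
  split_ifs <;> omega

/-- The places up to that of `i` fill an arc with `i` at its clockwise end if `i` is in the first
half, and at its other end otherwise. The arc between `a` and `i` on the relevant side stays inside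
it. -/
lemma place_lt_of_mem_arc (h : IsShuffleCycle σ w) {a i k : Fin (2 * n)} (hai : w i = w a + 1)
    (hk : i.val < n ∧ k ∈ arc a i ∨ n ≤ i.val ∧ k ∈ arc i a) (hki : k ≠ i) (hka : k ≠ a) :
    w k < w a := by
  rw [mem_arc, mem_arc] at hk
  have hvki := Fin.val_ne_iff.2 hki
  have hvka := Fin.val_ne_iff.2 hka
  have e1 := h.lt_iff k i
  have e2 := h.lt_iff k a
  have e3 := h.lt_iff a i
  by_cases hi : i.val < n <;> by_cases ha : a.val < n <;> by_cases hkn : k.val < n <;>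
    simp only [hi, ha, hkn, not_true_eq_false, not_false_eq_true, forall_const,
      IsEmpty.forall_iff, true_and] at e1 e2 e3 <;> omega

/-- Dually, the places from that of `i` onwards fill an arc having `i` as an end. -/
lemma le_place_of_mem_arc (h : IsShuffleCycle σ w) {b i k : Fin (2 * n)} (hib : w b = w i + 1)
    (hk : i.val < n ∧ k ∈ arc i b ∨ n ≤ i.val ∧ k ∈ arc b i) : w i ≤ w k := by
  rw [mem_arc, mem_arc] at hk
  have e1 := h.lt_iff k i
  have e2 := h.lt_iff k b
  have e3 := h.lt_iff i b
  by_cases hi : i.val < n <;> by_cases hb : b.val < n <;> by_cases hkn : k.val < n <;>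
    simp only [hi, hb, hkn, not_true_eq_false, not_false_eq_true, forall_const,
      IsEmpty.forall_iff, true_and] at e1 e2 e3 <;> omega

lemma inClockwiseOrder_place (h : IsShuffleCycle σ w) {a b i : Fin (2 * n)} (hai : w i = w a + 1)
    (hib : w b = w i + 1) :
    (i.val < n → InClockwiseOrder a i i b) ∧ (n ≤ i.val → InClockwiseOrder i a b i) := by
  have eab := h.lt_iff a b
  have eai := h.lt_iff a i
  have eib := h.lt_iff i b
  have hal := a.isLt
  have hil := i.isLt
  have hbl := b.isLt
  have hia : i ≠ a := by
    rintro rfl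
    omega
  refine ⟨fun hi => ⟨hia.symm, le_rfl, Or.inl ?_⟩, fun hi => ⟨hia, ?_, Or.inr rfl⟩⟩
  · rw [Fin.lt_def, val_sub_eq, val_sub_eq]
    split_ifs <;> omega
  · rw [Fin.le_def, val_sub_eq, val_sub_eq]
    split_ifs <;> omega

lemma covers_loopAt (h : IsShuffleCycle σ w) {π : DecoratedPerm (2 * n)} (hπ : π.perm = σ)
    {i : Fin (2 * n)} (hi0 : i.val ≠ 0) (hin : i.val ≠ n) : Covers π (loopAt σ i) := by
  obtain ⟨a, ha⟩ := σ.surjective i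
  obtain ⟨b, hb⟩ : ∃ b, σ i = b := ⟨_, rfl⟩
  have han : a.val ≠ n := fun e => hi0 (ha ▸ h.last a e)
  have hia : i ≠ a := fun e => h.apply_ne a (ha.trans e)
  have hib : i ≠ b := fun e => h.apply_ne i (hb.trans e.symm)
  have hwi := h.succ a han
  have hwb := h.succ i hin
  rw [ha] at hwi
  rw [hb] at hwb
  have hab : a ≠ b := by
    rintro rfl
    omega
  have hπc : ∀ k, k ∉ π.ccw := fun k hk => h.apply_ne k (hπ ▸ π.ccw_fixed k hk)
  have hpi : (loopAt σ i).perm i = i := by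
    rw [loopAt, removeFromCycles_eq, hb, if_neg hib.symm, if_pos rfl]
  have hpa : (loopAt σ i).perm a = b := by
    rw [loopAt, removeFromCycles_eq, ha, if_pos rfl, hb]
  have hpk {k : Fin (2 * n)} (hki : k ≠ i) (hka : k ≠ a) : (loopAt σ i).perm k = σ k := by
    rw [loopAt, removeFromCycles_eq, if_neg hki,
      if_neg (fun e => hka (σ.injective (e.trans ha.symm)))]
  have hcc {k : Fin (2 * n)} (hki : k ≠ i) : k ∈ (loopAt σ i).ccw ↔ k ∈ π.ccw := by
    refine iff_of_false ?_ (hπc k)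
    rw [loopAt]
    split_ifs <;> simp [hki]
  have hcl := h.inClockwiseOrder_place hwi hwb
  have hno {k : Fin (2 * n)} (hki : k ≠ i) (hka : k ≠ a)
      (hk : i.val < n ∧ k ∈ arc a i ∨ n ≤ i.val ∧ k ∈ arc i a) :
      ¬ (i.val < n ∧ σ k ∈ arc i b ∨ n ≤ i.val ∧ σ k ∈ arc b i) := by
    intro hs
    have h1 := h.place_lt_of_mem_arc hwi hk hki hka
    have h2 := h.le_place_of_mem_arc hwb hs
    -- Away from `n + 1`, a forbidden chord would give `w i ≤ w k + 1 < w a + 1 = w i`.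
    by_cases hkn : k.val = n
    · rw [mem_arc, mem_arc] at hk
      have hk0 := h.last k hkn
      have h3 := h.lt_iff (σ k) i
      have h4 := h.lt_iff k a
      omega
    · have h3 := h.succ k hkn
      omega
  rcases lt_or_ge i.val n with hi | hi
  · have hno' {k : Fin (2 * n)} (hk : k ∈ arc a i) (hki : k ≠ i) (hka : k ≠ a) :
        σ k ∉ arc i b := fun hs => hno hki hka (Or.inl ⟨hi, hk⟩) (Or.inl ⟨hi, hs⟩)
    refine ⟨i, i, a, b, ⟨hcl.1 hi, by rw [hπ, hb], by rw [hπ, ha], ?_⟩,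
      ⟨hcl.1 hi, hpi, hpa, ?_, fun e => absurd e hab, ?_⟩, ?_⟩
    · intro k hk hki hka
      rw [hπ]
      exact hno' hk hki hka
    · intro _
      simp [loopAt, hi]
    · intro k hk hki hka
      rw [hpk hki hka]
      exact hno' hk hki hka
    · intro k hki hka
      exact ⟨by rw [hpk hki hka, hπ], hcc hki⟩
  · have hno' {k : Fin (2 * n)} (hk : k ∈ arc i a) (hka : k ≠ a) (hki : k ≠ i) :
        σ k ∉ arc b i := fun hs => hno hki hka (Or.inr ⟨hi, hk⟩) (Or.inr ⟨hi, hs⟩)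
    refine ⟨a, b, i, i, ⟨hcl.2 hi, by rw [hπ, ha], by rw [hπ, hb], ?_⟩,
      ⟨hcl.2 hi, hpa, hpi, fun e => absurd e hab, ?_, ?_⟩, ?_⟩
    · intro k hk hka hki
      rw [hπ]
      exact hno' hk hka hki
    · intro _
      simp [loopAt, hi.not_gt]
    · intro k hk hka hki
      rw [hpk hki hka]
      exact hno' hk hka hki
    · intro k hka hki
      exact ⟨by rw [hpk hki hka, hπ], hcc hki⟩

lemma exists_removeFromCycles_eq_iff {σ₁ σ₂ : Equiv.Perm (Fin (2 * n))} {w₁ w₂ : Fin (2 * n) → ℕ}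
    (h₁ : IsShuffleCycle σ₁ w₁) (h₂ : IsShuffleCycle σ₂ w₂) (hn : 2 ≤ n)
    {π₁ π₂ : DecoratedPerm (2 * n)} (hπ₁ : π₁.perm = σ₁) (hπ₂ : π₂.perm = σ₂) :
    (∃ π, Covers π₁ π ∧ Covers π₂ π) ↔ ∃ i : Fin (2 * n), i.val ≠ 0 ∧ i.val ≠ n ∧
      removeFromCycles σ₁ i = removeFromCycles σ₂ i := by
  constructor
  · rintro ⟨π, hc₁, hc₂⟩
    rcases h₁.exists_of_covers hπ₁ hc₁ with ⟨i, hi0, hin, hi⟩ | ⟨a, x, hx, hax, ha⟩ <;>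
      rcases h₂.exists_of_covers hπ₂ hc₂ with ⟨j, hj0, hjn, hj⟩ | ⟨b, y, hy, hby, hb⟩
    · have hij : i = j := by
        refine h₂.eq_of_removeFromCycles_apply hj0 hjn ?_
        rw [← hj, hi, removeFromCycles, Equiv.Perm.mul_apply, Equiv.swap_apply_right]
      exact ⟨i, hi0, hin, by rw [← hi, hj, hij]⟩
    · exact absurd (hi.symm.trans hb) (h₂.removeFromCycles_ne_mul_swap hi0 hin hy)
    · exact absurd (hj.symm.trans ha) (h₁.removeFromCycles_ne_mul_swap hj0 hjn hx)
    · obtain rfl : x = y := Fin.ext (hx.trans hy.symm)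
      have hxx : σ₁ x = σ₂ x := Fin.ext ((h₁.last x hx).trans (h₂.last x hx).symm)
      have he : σ₁ * Equiv.swap a x = σ₂ * Equiv.swap b x := ha.symm.trans hb
      -- Both `a` and `b` are the preimage of `σ₁ x = σ₂ x` under the common permutation.
      have hab : a = b := by
        refine (σ₂ * Equiv.swap b x).injective ?_
        rw [← he]
        nth_rw 2 [he]
        simp [hxx]
      subst hab
      have hσ : σ₁ = σ₂ := mul_right_cancel he
      -- The cycles agree, so any admissible point serves; `2 ≤ n` keeps this one different from `n
      -- + 1`.
      exact ⟨⟨1, by omega⟩, by simp, by simp only; omega, by rw [hσ]⟩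
  · rintro ⟨i, hi0, hin, hi⟩
    refine ⟨loopAt σ₁ i, h₁.covers_loopAt hπ₁ hi0 hin, ?_⟩
    -- The marking of the loop depends only on the half containing `i`.
    have : loopAt σ₁ i = loopAt σ₂ i := DecoratedPerm.ext hi rfl
    rw [this]
    exact h₂.covers_loopAt hπ₂ hi0 hin

end IsShuffleCycle

/-! ### The staircase shape of the antiadjacency matrix -/

section Staircase

variable {P : Type} [PartialOrder P] {n : ℕ} {l : P ≃ Fin n}

/-- Increasing `q` enlarges strict down-sets and shrinks strict up-sets. If the labels disagree with
`q`, canonicity makes the altitudes equal, so these nested sets coincide and `x`, `y` are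
interchangeable in the order. -/
lemma lt_of_label_le (hP : IsUnitIntervalOrder P) (hl : IsCanonicalLabeling l) {x y : P}
    (hxy : l x ≤ l y) (z : P) : (y < z → x < z) ∧ (z < x → z < y) := by
  obtain ⟨q, -, hq⟩ := hP
  have : Finite P := Finite.of_equiv _ l.symm
  rcases le_or_gt (q x) (q y) with h | h
  · simp only [hq]
    exact ⟨fun h' => by linarith, fun h' => by linarith⟩
  have hIio : Set.Iio y ⊆ Set.Iio x := fun z hz => by
    simp only [Set.mem_Iio, hq] at hz ⊢
    linarith
  have hIoi : Set.Ioi x ⊆ Set.Ioi y := fun z hz => by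
    simp only [Set.mem_Ioi, hq] at hz ⊢
    linarith
  have hIic (x : P) : Nat.card (Set.Iic x) = (Set.Iio x).ncard + 1 := by
    rw [Nat.card_coe_set_eq, ← Set.Iio_insert, Set.ncard_insert_of_notMem (by simp)]
  have hIci (x : P) : Nat.card (Set.Ici x) = (Set.Ioi x).ncard + 1 := by
    rw [Nat.card_coe_set_eq, ← Set.Ioi_insert, Set.ncard_insert_of_notMem (by simp)]
  have h1 := Set.ncard_le_ncard hIio
  have h2 := Set.ncard_le_ncard hIoi
  have h3 : ¬ altitude y < altitude x := fun h' => (hl y x h').not_ge hxy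
  rw [altitude, altitude, hIic, hIci, hIic, hIci] at h3
  have h4 := Set.eq_of_subset_of_ncard_le hIio (by omega)
  have h5 := Set.eq_of_subset_of_ncard_le hIoi (by omega)
  exact ⟨fun h' => by rw [← Set.mem_Ioi, h5]; exact h',
    fun h' => by rw [← Set.mem_Iio, h4]; exact h'⟩

lemma exists_nat_threshold (n : ℕ) (p : ℕ → Prop) (hp : ∀ i j, i ≤ j → j < n → p j → p i) :
    ∃ t ≤ n, ∀ i < n, (p i ↔ i < t) := by
  induction n with
  | zero => exact ⟨0, le_rfl, fun i hi => absurd hi (by omega)⟩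
  | succ n ih =>
    by_cases h : p n
    · exact ⟨n + 1, le_rfl, fun i hi => iff_of_true (hp i n (by omega) (by omega) h) hi⟩
    · obtain ⟨t, ht, h'⟩ := ih fun i j hij hj => hp i j hij (by omega)
      refine ⟨t, by omega, fun i hi => ?_⟩
      rcases Nat.lt_succ_iff_lt_or_eq.mp hi with hi | rfl
      · exact h' i hi
      · exact iff_of_false h (by omega)

/-- The signed partial sums of the standard basis. -/
def signedPrefix (n t : ℕ) : Fin n → ℝ := fun r => if r.val < t then (-1) ^ (n - 1 - r.val) else 0

/-- The vectors `v` are the standard basis followed by the signed partial sums of lengths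
`n = t 0 ≥ ⋯ ≥ t (n - 1) ≥ 1`, like the columns of `ψ(A)` for `A` of staircase shape. -/
structure IsStaircase {n : ℕ} (v : Fin (2 * n) → Fin n → ℝ) (t : ℕ → ℕ) : Prop where
  pos : ∀ j < n, 1 ≤ t j
  le : ∀ j < n, t j ≤ n
  anti : ∀ i j, i ≤ j → j < n → t j ≤ t i
  zero : t 0 = n
  left : ∀ k : Fin (2 * n), ∀ h : k.val < n, v k = Pi.single ⟨k.val, h⟩ 1
  right : ∀ k : Fin (2 * n), n ≤ k.val → v k = signedPrefix n (t (k.val - n))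

/-- Reversing the rows puts the ones of each column of `A` on top, and `t j` counts them. The least
label has nothing below it, so its column is full; the greatest has nothing above it, so no column
is empty. -/
lemma exists_isStaircase (hP : IsUnitIntervalOrder P) (hl : IsCanonicalLabeling l) (hn : 0 < n) :
    ∃ t, IsStaircase (fun k => (psi (antiadjacency l)).col k) t := by
  have hmono {a b : Fin n} (hab : a ≤ b) (z : Fin n) :
      (l.symm b < l.symm z → l.symm a < l.symm z) ∧ (l.symm z < l.symm a → l.symm z < l.symm b) :=
    lt_of_label_le hP hl (by simpa using hab) _
  have key : ∀ j : ℕ, ∃ t ≤ n, ∀ r (hr : r < n) (hj : j < n),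
      (¬ l.symm (Fin.rev ⟨r, hr⟩) < l.symm ⟨j, hj⟩ ↔ r < t) := by
    intro j
    by_cases hj : j < n
    · obtain ⟨t, ht, h⟩ := exists_nat_threshold n
        (fun r => ∀ hr : r < n, ¬ l.symm (Fin.rev ⟨r, hr⟩) < l.symm ⟨j, hj⟩)
        (fun r r' hrr hr' h hr h' => h hr' ((hmono (by
          simp only [Fin.le_def, Fin.val_rev]; omega) _).1 h'))
      exact ⟨t, ht, fun r hr _ => by rw [← h r hr]; exact ⟨fun h' _ => h', fun h' => h' hr⟩⟩
    · exact ⟨0, Nat.zero_le _, fun r hr hj' => absurd hj' hj⟩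
  choose t ht h using key
  refine ⟨t, ⟨fun j hj => ?_, fun j _ => ht j, fun i j hij hj => ?_, ?_, fun k hk => ?_,
    fun k hk => ?_⟩⟩
  · refine (h j 0 hn hj).1 fun h' => lt_irrefl _ ((hmono ?_ _).1 h')
    simp only [Fin.le_def, Fin.val_rev]
    omega
  · by_contra! hlt
    have hi : t i < n := by have := ht j; omega
    refine lt_irrefl (t i) ((h i _ hi (by omega)).1 fun h' => ?_)
    exact (h j _ hi hj).2 hlt ((hmono (by simpa [Fin.le_def] using hij) _).2 h')
  · refine le_antisymm (ht 0) ?_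
    have : n - 1 < t 0 := (h 0 (n - 1) (by omega) hn).1 (by
      rw [show (Fin.rev ⟨n - 1, by omega⟩ : Fin n) = ⟨0, hn⟩ from Fin.ext (by simp; omega)]
      exact lt_irrefl _)
    omega
  · ext r
    simp only [Matrix.col_apply, psi, Matrix.of_apply, dif_pos hk, Pi.single_apply, Fin.ext_iff]
  · ext r
    have := h (k.val - n) r.val r.isLt (by omega)
    simp only [Matrix.col_apply, psi, Matrix.of_apply, dif_neg hk.not_gt, antiadjacency,
      signedPrefix]
    split_ifs with h1 h2 h2
    · exact absurd h1 (this.2 h2)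
    · simp
    · simp
    · exact absurd (this.1 h1) h2

end Staircase

/-! ### The decorated permutation of a staircase -/

namespace IsStaircase

variable {n : ℕ} {v : Fin (2 * n) → Fin n → ℝ} {t : ℕ → ℕ}

lemma signedPrefix_succ_sub {r : ℕ} (hr : r < n) :
    signedPrefix n (r + 1) - signedPrefix n r =
      Pi.single (M := fun _ : Fin n => ℝ) ⟨r, hr⟩ ((-1) ^ (n - 1 - r)) := by
  ext k
  simp only [signedPrefix, Pi.sub_apply, Pi.single_apply, Fin.ext_iff]
  rcases lt_trichotomy k.val r with h | h | h
  · rw [if_pos (by omega), if_pos h, if_neg h.ne, sub_self]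
  · rw [if_pos (by omega), if_neg (by omega), if_pos h, sub_zero, h]
  · rw [if_neg (by omega), if_neg (by omega), if_neg (by omega), sub_zero]

lemma signedPrefix_zero : signedPrefix n 0 = 0 := by
  ext k
  simp [signedPrefix]

lemma left_eq (hv : IsStaircase v t) (k : Fin (2 * n)) (hk : k.val < n) :
    v k = (-1 : ℝ) ^ (n - 1 - k.val) • (signedPrefix n (k.val + 1) - signedPrefix n k.val) := by
  rw [hv.left k hk, signedPrefix_succ_sub hk, ← Pi.single_smul, smul_eq_mul, ← mul_pow]
  simp

lemma left_mem_iff (hv : IsStaircase v t) (k : Fin (2 * n)) (hk : k.val < n)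
    (W : Submodule ℝ (Fin n → ℝ)) :
    v k ∈ W ↔ signedPrefix n (k.val + 1) - signedPrefix n k.val ∈ W := by
  rw [hv.left_eq k hk]
  exact Submodule.smul_mem_iff _ (pow_ne_zero _ (by norm_num))

/-- The path edges from vertex `a` to vertex `b` telescope. -/
lemma sub_mem_of_forall (hv : IsStaircase v t) (W : Submodule ℝ (Fin n → ℝ)) {a b : ℕ}
    (hab : a ≤ b) (hb : b ≤ n)
    (h : ∀ k : Fin (2 * n), a ≤ k.val → k.val < b → v k ∈ W) :
    signedPrefix n b - signedPrefix n a ∈ W := by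
  induction b, hab using Nat.le_induction with
  | base => simp
  | succ b hab ih =>
    have h1 := ih (by omega) fun k hk hkb => h k hk (by omega)
    have h2 := (hv.left_mem_iff ⟨b, by omega⟩ (by simp only; omega) W).1
      (h ⟨b, by omega⟩ hab (by simp))
    simpa using W.add_mem h2 h1

lemma span_range (hv : IsStaircase v t) : Submodule.span ℝ (Set.range v) = ⊤ := by
  rw [eq_top_iff, ← (Pi.basisFun ℝ (Fin n)).span_eq]
  refine Submodule.span_mono ?_
  rintro _ ⟨r, rfl⟩
  exact ⟨⟨r.val, by omega⟩, by rw [hv.left _ r.isLt]; simp⟩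

/-- The functional on column vectors given by the potential differences of `c`. -/
noncomputable def potential (n : ℕ) (c : ℕ → ℝ) : (Fin n → ℝ) →ₗ[ℝ] ℝ :=
  ∑ r : Fin n, ((-1) ^ (n - 1 - r.val) * (c (r.val + 1) - c r.val)) • LinearMap.proj r

lemma potential_single (c : ℕ → ℝ) (r : Fin n) (a : ℝ) :
    potential n c (Pi.single r a) = (-1) ^ (n - 1 - r.val) * (c (r.val + 1) - c r.val) * a := by
  simp [potential, Pi.single_apply, LinearMap.sum_apply]

lemma potential_signedPrefix (c : ℕ → ℝ) {s : ℕ} (hs : s ≤ n) :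
    potential n c (signedPrefix n s) = c s - c 0 := by
  induction s with
  | zero => simp [signedPrefix_zero]
  | succ s ih =>
    have h1 := signedPrefix_succ_sub (n := n) (r := s) (by omega)
    rw [sub_eq_iff_eq_add.1 h1, map_add, potential_single, ih (by omega)]
    have : ((-1 : ℝ) ^ (n - 1 - s)) * (-1) ^ (n - 1 - s) = 1 := by rw [← mul_pow]; simp
    linear_combination (c (s + 1) - c s) * this

lemma potential_left (hv : IsStaircase v t) (c : ℕ → ℝ) (k : Fin (2 * n)) (hk : k.val < n) :
    potential n c (v k) = (-1) ^ (n - 1 - k.val) * (c (k.val + 1) - c k.val) := by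
  rw [hv.left k hk, potential_single, mul_one]

lemma potential_right (hv : IsStaircase v t) (c : ℕ → ℝ) (k : Fin (2 * n)) (hk : n ≤ k.val) :
    potential n c (v k) = c (t (k.val - n)) - c 0 := by
  rw [hv.right k hk, potential_signedPrefix c (hv.le _ (by omega))]

/-- Cut criterion: a vertex potential that is constant along the edges in `S` but not along `y`
separates `v y` from their span. -/
lemma notMem_span_of_potential (hv : IsStaircase v t) (c : ℕ → ℝ) (S : Set (Fin (2 * n)))
    (y : Fin (2 * n)) (hl : ∀ k ∈ S, k.val < n → c (k.val + 1) = c k.val)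
    (hr : ∀ k ∈ S, n ≤ k.val → c (t (k.val - n)) = c 0)
    (hyl : y.val < n → c (y.val + 1) ≠ c y.val)
    (hyr : n ≤ y.val → c (t (y.val - n)) ≠ c 0) :
    v y ∉ Submodule.span ℝ (v '' S) := by
  intro hy
  have h0 : v y ∈ LinearMap.ker (potential n c) := by
    refine (Submodule.span_le.2 ?_) hy
    rintro _ ⟨k, hk, rfl⟩
    rw [SetLike.mem_coe, LinearMap.mem_ker]
    rcases lt_or_ge k.val n with h | h
    · rw [hv.potential_left c k h, hl k hk h, sub_self, mul_zero]
    · rw [hv.potential_right c k h, hr k hk h, sub_self]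
  rw [LinearMap.mem_ker] at h0
  rcases lt_or_ge y.val n with h | h
  · rw [hv.potential_left c y h] at h0
    exact mul_ne_zero (pow_ne_zero _ (by norm_num)) (sub_ne_zero.2 (hyl h)) h0
  · rw [hv.potential_right c y h] at h0
    exact hyr h (sub_eq_zero.1 h0)

end IsStaircase

namespace IsStaircase

variable {n : ℕ} {v : Fin (2 * n) → Fin n → ℝ} {t : ℕ → ℕ}

/-! ### The chord ending at each point, from a cycle and a cut of the graph -/

section Perm

variable {M : Matroid (Fin (2 * n))} {π : DecoratedPerm (2 * n)}

lemma perm_last (hv : IsStaircase v t)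
    (hM : ∀ S : Set (Fin (2 * n)), M.IsBase S ↔
      LinearIndepOn ℝ v S ∧ Submodule.span ℝ (v '' S) = ⊤)
    (hπ : IsDecoratedPermOf π M) {x y : Fin (2 * n)} (hx : x.val = n) (hy : y.val = 0) :
    π.perm x = y := by
  have hn : 0 < n := by have := x.isLt; omega
  refine perm_apply_eq_of_mem_span hM hv.span_range hπ (fun e => by simp [e, hy] at hx; omega) ?_ ?_
  · set W := Submodule.span ℝ (v '' {k | 0 < (k - y).val ∧ (k - y).val ≤ (x - y).val})
    have hW (k : Fin (2 * n)) (hk0 : 0 < k.val) (hkn : k.val ≤ n) : v k ∈ W := by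
      refine Submodule.subset_span ⟨k, ?_, rfl⟩
      simp only [Set.mem_ofPred_eq, val_sub_eq, hx, hy]
      simp only [zero_le, if_true]
      omega
    have h1 := hW x (by omega) (by omega)
    rw [hv.right x hx.ge, hx, Nat.sub_self, hv.zero] at h1
    have h2 := hv.sub_mem_of_forall W (a := 1) hn le_rfl
      fun k hk hkn => hW k (by omega) (by omega)
    rw [hv.left_mem_iff y (by omega), hy, signedPrefix_zero, sub_zero]
    simpa using W.sub_mem h1 h2
  -- The cut isolates vertex `0`.
  · refine hv.notMem_span_of_potential (fun s => if s = 0 then 1 else 0) _ y ?_ ?_ ?_ ?_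
    · rintro k ⟨hk1, -⟩ -
      simp only [val_sub_eq, hy] at hk1 ⊢
      rw [if_neg (by omega), if_neg (by split_ifs at hk1 <;> omega)]
    · rintro k ⟨-, hk2⟩ hkn
      simp only [val_sub_eq, hx, hy] at hk2
      split_ifs at hk2 <;> omega
    · intro _
      simp [hy]
    · omega

lemma perm_left_of_eq (hv : IsStaircase v t)
    (hM : ∀ S : Set (Fin (2 * n)), M.IsBase S ↔
      LinearIndepOn ℝ v S ∧ Submodule.span ℝ (v '' S) = ⊤)
    (hπ : IsDecoratedPermOf π M) {x y : Fin (2 * n)} (hy0 : 0 < y.val) (hyn : y.val < n)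
    (hx : n ≤ x.val) (ht : t (x.val - n) = y.val) (hlt : ∀ j < x.val - n, y.val < t j) :
    π.perm x = y := by
  have hxl := x.isLt
  have hxn : x.val ≠ n := fun h => by
    rw [h, Nat.sub_self, hv.zero] at ht
    omega
  refine perm_apply_eq_of_mem_span hM hv.span_range hπ (fun e => by rw [e] at hx; omega) ?_ ?_
  · set W := Submodule.span ℝ (v '' {k | 0 < (k - y).val ∧ (k - y).val ≤ (x - y).val})
    have hW (k : Fin (2 * n)) (hk0 : y.val < k.val) (hkn : k.val ≤ x.val) : v k ∈ W := by
      refine Submodule.subset_span ⟨k, ?_, rfl⟩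
      simp only [Set.mem_ofPred_eq, val_sub_eq]
      split_ifs <;> omega
    -- The cycle climbs from `y` to vertex `n`, returns to `0` by the first right edge and reaches
    -- vertex `y` by edge `x`.
    have h1 := hW ⟨n, by omega⟩ hyn hx
    rw [hv.right _ le_rfl, Nat.sub_self, hv.zero] at h1
    have h3 := hW x (by omega) (by omega)
    rw [hv.right _ hx, ht] at h3
    have h2 := hv.sub_mem_of_forall W (a := y.val + 1) hyn le_rfl
      fun k hk hkn => hW k (by omega) (by omega)
    rw [hv.left_mem_iff y hyn]
    simpa using W.sub_mem (W.sub_mem h1 h2) h3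
  -- The cut isolates `{1, …, y}`, which right edges of height above `y` avoid.
  · refine hv.notMem_span_of_potential (fun s => if 0 < s ∧ s ≤ y.val then 1 else 0) _ y ?_ ?_ ?_ ?_
    · rintro k ⟨hk1, hk2⟩ -
      simp only [val_sub_eq] at hk1 hk2
      have : y.val < k.val := by split_ifs at * <;> omega
      rw [if_neg (by omega), if_neg (by omega)]
    · rintro k ⟨hk1, hk2⟩ hkn
      simp only [val_sub_eq] at hk1 hk2
      have := hlt (k.val - n) (by split_ifs at * <;> omega)
      rw [if_neg (by omega), if_neg (by omega)]
    · intro _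
      simp [hy0]
    · omega

lemma perm_left_of_ne (hv : IsStaircase v t)
    (hM : ∀ S : Set (Fin (2 * n)), M.IsBase S ↔
      LinearIndepOn ℝ v S ∧ Submodule.span ℝ (v '' S) = ⊤)
    (hπ : IsDecoratedPermOf π M) {x y : Fin (2 * n)} (hyn : y.val < n)
    (hx : x.val + 1 = y.val) (hne : ∀ j < n, t j ≠ y.val) :
    π.perm x = y := by
  refine perm_apply_eq_of_mem_span hM hv.span_range hπ (fun e => by rw [e] at hx; omega) ?_ ?_
  · set W := Submodule.span ℝ (v '' {k | 0 < (k - y).val ∧ (k - y).val ≤ (x - y).val})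
    have hW (k : Fin (2 * n)) (hk : k.val ≠ y.val) : v k ∈ W := by
      have := k.isLt
      refine Submodule.subset_span ⟨k, ?_, rfl⟩
      simp only [Set.mem_ofPred_eq, val_sub_eq]
      split_ifs <;> omega
    have h1 := hW ⟨n, by omega⟩ hyn.ne'
    rw [hv.right _ le_rfl, Nat.sub_self, hv.zero] at h1
    have h2 := hv.sub_mem_of_forall W (a := y.val + 1) hyn le_rfl
      fun k hk hkn => hW k (by omega)
    have h3 := hv.sub_mem_of_forall W (a := 0) (b := y.val) (by omega) hyn.le
      fun k hk hkn => hW k (by omega)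
    rw [hv.left_mem_iff y hyn]
    rw [signedPrefix_zero, sub_zero] at h3
    simpa using W.sub_mem (W.sub_mem h1 h2) h3
  -- No right edge ends at vertex `y`, so only the path edges `x` and `y` meet it.
  · refine hv.notMem_span_of_potential (fun s => if s = y.val then 1 else 0) _ y ?_ ?_ ?_ ?_
    · rintro k ⟨hk1, hk2⟩ hkn
      simp only [val_sub_eq] at hk1 hk2
      have : k.val ≠ y.val ∧ k.val + 1 ≠ y.val := by split_ifs at * <;> omega
      rw [if_neg this.1, if_neg this.2]
    · rintro k ⟨hk1, hk2⟩ hkn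
      have := hne (k.val - n) (by omega)
      rw [if_neg (by omega), if_neg (by omega)]
    · intro _
      simp
    · omega

lemma perm_right_of_eq (hv : IsStaircase v t)
    (hM : ∀ S : Set (Fin (2 * n)), M.IsBase S ↔
      LinearIndepOn ℝ v S ∧ Submodule.span ℝ (v '' S) = ⊤)
    (hπ : IsDecoratedPermOf π M) {x y : Fin (2 * n)} (hyn : n ≤ y.val)
    (hx : x.val = y.val + 1) (ht : t (x.val - n) = t (y.val - n)) :
    π.perm x = y := by
  have h1 : (x - y).val = 1 := by
    rw [val_sub_eq]
    split_ifs <;> omega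
  refine perm_apply_eq_of_mem_span hM hv.span_range hπ (fun e => by rw [e] at hx; omega) ?_ ?_
  · rw [hv.right y hyn, ← ht, ← hv.right x (by omega)]
    exact Submodule.subset_span ⟨x, by simp [h1], rfl⟩
  · have hp := hv.pos (y.val - n) (by omega)
    refine hv.notMem_span_of_potential (fun s => if s = 0 then 1 else 0) _ y ?_ ?_ ?_ ?_
    · rintro k ⟨hk1, hk2⟩
      omega
    · rintro k ⟨hk1, hk2⟩
      omega
    · omega
    · intro _
      simp only
      rw [if_neg (by omega)]
      simp

lemma perm_right_of_lt (hv : IsStaircase v t)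
    (hM : ∀ S : Set (Fin (2 * n)), M.IsBase S ↔
      LinearIndepOn ℝ v S ∧ Submodule.span ℝ (v '' S) = ⊤)
    (hπ : IsDecoratedPermOf π M) {x y : Fin (2 * n)} (hyn : n ≤ y.val)
    (hx : x.val + 1 = t (y.val - n)) (hlt : ∀ j < n, y.val - n < j → t j < t (y.val - n)) :
    π.perm x = y := by
  have hyl := y.isLt
  have hle := hv.le (y.val - n) (by omega)
  refine perm_apply_eq_of_mem_span hM hv.span_range hπ (fun e => by rw [e] at hx; omega) ?_ ?_
  · set W := Submodule.span ℝ (v '' {k | 0 < (k - y).val ∧ (k - y).val ≤ (x - y).val})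
    have hW (k : Fin (2 * n)) (hk : k.val ≤ x.val) : v k ∈ W := by
      have := k.isLt
      refine Submodule.subset_span ⟨k, ?_, rfl⟩
      simp only [Set.mem_ofPred_eq, val_sub_eq]
      split_ifs <;> omega
    have h3 := hv.sub_mem_of_forall W (a := 0) (b := x.val + 1) (by omega) (by omega)
      fun k hk hkn => hW k (by omega)
    rwa [signedPrefix_zero, sub_zero, hx, ← hv.right y hyn] at h3
  -- Without edge `x`, no remaining edge climbs to the height of `y`, since later right edges are
  -- shorter.
  · refine hv.notMem_span_of_potential (fun s => if x.val < s then 1 else 0) _ y ?_ ?_ ?_ ?_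
    · rintro k ⟨hk1, hk2⟩ hkn
      simp only [val_sub_eq] at hk1 hk2
      have : k.val < x.val := by split_ifs at * <;> omega
      rw [if_neg (by omega), if_neg (by omega)]
    · rintro k ⟨hk1, hk2⟩ hkn
      simp only [val_sub_eq] at hk1 hk2
      have := hlt (k.val - n) (by omega) (by split_ifs at * <;> omega)
      rw [if_neg (by omega), if_neg (by omega)]
    · omega
    · intro _
      rw [if_pos (by omega), if_neg (by omega)]
      simp

/-- The decorated permutation of a staircase is read off its boundary path. -/
lemma exists_isShuffleCycle (hv : IsStaircase v t)
    (hM : ∀ S : Set (Fin (2 * n)), M.IsBase S ↔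
      LinearIndepOn ℝ v S ∧ Submodule.span ℝ (v '' S) = ⊤) :
    ∃ w, ∀ π, IsDecoratedPermOf π M → IsShuffleCycle π.perm w := by
  have hex (i : ℕ) := exists_nat_threshold n (fun j => i < t j)
    (fun j k hjk hk h => lt_of_lt_of_le h (hv.anti j k hjk hk))
  choose d hd hdt using hex
  have hdanti {i k : ℕ} (hik : i ≤ k) : d k ≤ d i := by
    by_contra! h
    have h1 := hd k
    have h2 := hdt k (d i) (by omega)
    have h3 := hdt i (d i) (by omega)
    omega
  -- `d i` counts the columns of height above `i`. The place of a point counts the earlier points of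
  -- its own half, then those of the other half; equivalently, its step on the boundary path.
  refine ⟨fun x => if x.val < n then x.val + (n - d x.val)
    else (2 * n - 1 - x.val) + t (x.val - n), fun π hπ => ?_⟩
  have hup {x y : Fin (2 * n)} (hxy : x.val < y.val) := hdanti hxy.le
  have hdown {x y : Fin (2 * n)} (hxn : n ≤ x.val) (hxy : x.val < y.val) :=
    hv.anti (x.val - n) (y.val - n) (by omega) (by omega)
  have hne {x y : Fin (2 * n)} (hx : x.val < n) (hy : n ≤ y.val) :
      x.val + (n - d x.val) ≠ (2 * n - 1 - y.val) + t (y.val - n) := by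
    have h1 := hdt x.val (y.val - n) (by omega)
    have h2 := hd x.val
    omega
  have hstep (y : Fin (2 * n)) (hy0 : y.val ≠ 0) : ∃ x, π.perm x = y ∧
      (if y.val < n then y.val + (n - d y.val) else (2 * n - 1 - y.val) + t (y.val - n)) =
      (if x.val < n then x.val + (n - d x.val) else (2 * n - 1 - x.val) + t (x.val - n)) + 1 := by
    have hyl := y.isLt
    rcases lt_or_ge y.val n with hy | hy
    · have h1 := hd y.val
      -- `d y` is the first column of height at most `y`, hence the first of height `y` if there is
      -- one.
      by_cases ht : d y.val < n ∧ t (d y.val) = y.val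
      · refine ⟨⟨n + d y.val, by omega⟩, hv.perm_left_of_eq hM hπ (by omega) hy ?_ ?_ ?_, ?_⟩
        · simp
        · simpa using ht.2
        · intro j hj
          simp only [Nat.add_sub_cancel_left] at hj
          exact (hdt _ j (by omega)).2 hj
        · simp only [Nat.add_sub_cancel_left]
          rw [if_pos hy, if_neg (by omega), ht.2]
          omega
      · have hne : ∀ j < n, t j ≠ y.val := by
          intro j hj hjt
          have h2 := hdt y.val j hj
          have h3 := hv.anti (d y.val) j (by omega) hj
          have h4 := hdt y.val (d y.val) (by omega)
          exact ht ⟨by omega, by omega⟩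
        refine ⟨⟨y.val - 1, by omega⟩, hv.perm_left_of_ne hM hπ hy (by simp only; omega) hne, ?_⟩
        have h2 : d (y.val - 1) = d y.val := by
          refine le_antisymm ?_ (hdanti (by omega))
          by_contra! h
          have h3 := hd (y.val - 1)
          have h4 := hdt (y.val - 1) (d y.val) (by omega)
          have h5 := hdt y.val (d y.val) (by omega)
          have h6 := hne (d y.val) (by omega)
          omega
        simp only
        rw [if_pos hy, if_pos (by omega), h2]
        omega
    · by_cases ht : y.val + 1 < 2 * n ∧ t (y.val + 1 - n) = t (y.val - n)
      · refine ⟨⟨y.val + 1, ht.1⟩, hv.perm_right_of_eq hM hπ hy rfl ht.2, ?_⟩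
        simp only
        rw [if_neg (by omega), if_neg (by omega), ht.2]
        omega
      · have h1 := hv.pos (y.val - n) (by omega)
        have h2 := hv.le (y.val - n) (by omega)
        have hlt : ∀ j < n, y.val - n < j → t j < t (y.val - n) := by
          intro j hj hyj
          have h3 := hv.anti (y.val + 1 - n) j (by omega) hj
          have h4 := hv.anti (y.val - n) (y.val + 1 - n) (by omega) (by omega)
          omega
        refine ⟨⟨t (y.val - n) - 1, by omega⟩,
          hv.perm_right_of_lt hM hπ hy (by simp only; omega) hlt, ?_⟩
        have h3 : d (t (y.val - n) - 1) = y.val - n + 1 := by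
          have h4 := hd (t (y.val - n) - 1)
          have h5 := hdt (t (y.val - n) - 1) (y.val - n) (by omega)
          by_contra h6
          have h7 := hdt (t (y.val - n) - 1) (y.val - n + 1) (by omega)
          have h8 := hlt (y.val - n + 1) (by omega) (by omega)
          omega
        simp only
        rw [if_neg (by omega), if_pos (by omega), h3]
        omega
  have hlast (x : Fin (2 * n)) (hx : x.val = n) : (π.perm x).val = 0 := by
    rw [hv.perm_last hM hπ hx (y := ⟨0, by omega⟩) rfl]
  refine ⟨fun x y hxy => ?_, fun x y hxy hy => ?_, fun x y hx hxy => ?_, fun x hx => ?_, hlast⟩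
  · rcases lt_trichotomy x.val y.val with h | h | h
    · have h1 := @hup _ _ h
      have h2 := fun hn => @hdown _ _ hn h
      have h3 := @hne x y
      split_ifs at hxy <;> omega
    · exact Fin.ext h
    · have h1 := @hup _ _ h
      have h2 := fun hn => @hdown _ _ hn h
      have h3 := @hne y x
      split_ifs at hxy <;> omega
  · have h1 := hup hxy
    rw [if_pos hy, if_pos (by omega)]
    omega
  · have h1 := hdown hx hxy
    have h2 := y.isLt
    rw [if_neg (by omega), if_neg (by omega)]
    omega
  · have hσ0 : (π.perm x).val ≠ 0 := by
      intro h0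
      have hn : n < 2 * n := by have := x.isLt; omega
      have := hlast ⟨n, hn⟩ rfl
      have : π.perm x = π.perm ⟨n, hn⟩ := Fin.ext (by omega)
      exact hx (by rw [π.perm.injective this])
    obtain ⟨x', hx', h⟩ := hstep (π.perm x) hσ0
    rw [π.perm.injective hx'] at h
    exact h

end Perm

end IsStaircase

/-! ### Application to unit interval positroids -/

lemma IsUnitIntervalPositroid.exists_isShuffleCycle {n : ℕ} {M : Matroid (Fin (2 * n))}
    (hM : IsUnitIntervalPositroid n M) (hn : 0 < n) :
    ∃ w, ∀ π, IsDecoratedPermOf π M → IsShuffleCycle π.perm w := by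
  obtain ⟨P, _, l, hP, hl, hrep⟩ := hM
  obtain ⟨t, ht⟩ := exists_isStaircase hP hl hn
  exact ht.exists_isShuffleCycle hrep.2

lemma IsUnitIntervalPositroid.eq_of_le_one {n : ℕ} {M₁ M₂ : Matroid (Fin (2 * n))}
    (h₁ : IsUnitIntervalPositroid n M₁) (h₂ : IsUnitIntervalPositroid n M₂) (hn : n ≤ 1) :
    M₁ = M₂ := by
  obtain ⟨P₁, _, l₁, -, -, hE₁, h₁⟩ := h₁
  obtain ⟨P₂, _, l₂, -, -, hE₂, h₂⟩ := h₂
  have : Subsingleton (Fin n) := Fin.subsingleton_iff_le_one.2 hn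
  have hA : antiadjacency l₁ = antiadjacency l₂ := by
    ext i j
    obtain rfl := Subsingleton.elim i j
    simp [antiadjacency]
  refine Matroid.ext_isBase (hE₁.trans hE₂.symm) fun S _ => ?_
  rw [h₁, h₂, hA]

end UnitIntervalPositroid

theorem mainTheorem5 (n : ℕ) (P₁ P₂ : Matroid (Fin (2 * n)))
    (hP₁ : UnitIntervalPositroid.IsUnitIntervalPositroid n P₁)
    (hP₂ : UnitIntervalPositroid.IsUnitIntervalPositroid n P₂)
    (hne : P₁ ≠ P₂)
    (π₁ π₂ : UnitIntervalPositroid.DecoratedPerm (2 * n))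
    (hπ₁ : UnitIntervalPositroid.IsDecoratedPermOf π₁ P₁)
    (hπ₂ : UnitIntervalPositroid.IsDecoratedPermOf π₂ P₂) :
    UnitIntervalPositroid.LabelAdjacentCells P₁ P₂ ↔
      ∃ i : Fin (2 * n), (i : ℕ) ≠ 0 ∧ (i : ℕ) ≠ n ∧
        UnitIntervalPositroid.removeFromCycles π₁.perm i =
          UnitIntervalPositroid.removeFromCycles π₂.perm i := by
  have hn : 2 ≤ n := by
    by_contra! h
    exact hne (hP₁.eq_of_le_one hP₂ (by omega))
  obtain ⟨w₁, h₁⟩ := hP₁.exists_isShuffleCycle (by omega)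
  obtain ⟨w₂, h₂⟩ := hP₂.exists_isShuffleCycle (by omega)
  constructor
  · rintro ⟨ρ₁, ρ₂, π, hρ₁, hρ₂, hc⟩
    -- The places depend only on the positroid and determine the permutation, so `ρ₁`, `ρ₂` may
    -- replace `π₁`, `π₂`.
    rw [← (h₁ ρ₁ hρ₁).perm_unique (h₁ π₁ hπ₁), ← (h₂ ρ₂ hρ₂).perm_unique (h₂ π₂ hπ₂)]
    exact ((h₁ ρ₁ hρ₁).exists_removeFromCycles_eq_iff (h₂ ρ₂ hρ₂) hn rfl rfl).1 ⟨π, hc⟩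
  · intro h
    obtain ⟨π, hc⟩ :=
      ((h₁ π₁ hπ₁).exists_removeFromCycles_eq_iff (h₂ π₂ hπ₂) hn rfl rfl).2 h
    exact ⟨π₁, π₂, π, hπ₁, hπ₂, hc⟩
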